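/- Let $\Omega\subset\mathbb R^d$ be a bounded open set, $\alpha\in(0,1)$, $\gamma,\varepsilon,T>0$, $M\ge 1$, $N\ge 1$, $\Delta t=T/N$, and $$b_k=\frac{(k+1)^{1-\alpha}-k^{1-\alpha}}{\Gamma(2-\alpha)\,\Delta t^{\alpha}},\qquad \overline\partial_t^\alpha u^n=\sum_{k=1}^n b_{n-k}(u^k-u^{k-1}).$$ Let $\tilde F$ be the truncated double-well potential, $\tilde F(s)=\frac14(s^2-1)^2$ for $|s|\le M$ and $$\tilde F(s)=\tfrac12(3M^2-1)(|s|-M)^2+(M^3-M)(|s|-M)+\tfrac14(M^2-1)^2\quad\text{for } |s|\ge M,$$ and put $\tilde f=\tilde F'$, $L=3M^2-1$ and $E(u)=\int_\Omega\big(\frac{\varepsilon^2}{2}|\nabla u|^2+\tilde F(u)\big)\,dx$. Fix one of three boundary conditions with its energy space $V$: homogeneous Dirichlet, $V=H^1_0(\Omega)$; homogeneous Neumann, $V=H^1(\Omega)$; periodic on a box $\Omega=\prod_i(0,\ell_i)$, $V=H^1_{\rm per}(\Omega)$. Let $u^0,\dots,u^N\in V$ be a weak solution of the stabilized L1-IMEX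 scheme for the time-fractional Cahn--Hilliard equation $$\overline\partial_t^\alpha u^n=\gamma\Delta w^n,\qquad w^n=-\varepsilon^2\Delta u^n+\tilde f(u^{n-1})+S(u^n-u^{n-1}),\qquad 1\le n\le N,$$ that is, for each such $n$ there is $w^n\in V$ such that for all $\varphi\in V$, with $\langle\cdot,\cdot\rangle$ the $L^2(\Omega)$ inner product, $$\langle\overline\partial_t^\alpha u^n,\varphi\rangle=-\gamma\langle\nabla w^n,\nabla\varphi\rangle,\qquad \langle w^n,\varphi\rangle=\varepsilon^2\langle\nabla u^n,\nabla\varphi\rangle+\langle\tilde f(u^{n-1})+S(u^n-u^{n-1}),\varphi\rangle .$$ For $0\le k<n\le N$ let $\Psi^{n,k}\in V$ be a weak solution of $-\Delta\Psi^{n,k}=u^n-u^k$ with the same boundary condition, that is, $\langle\nabla\Psi^{n,k},\nabla\varphi\rangle=\langle u^n-u^k,\varphi\rangle$ for all $\varphi\in V$. Define $\widetilde E(u^0)=E(u^0)$ and, for $1\le n\le N$, $$\widetilde E(u^n)=E(u^n)+\frac1{2\gamma}\sum_{k=1}^{n-1}(b_{n-k-1}-b_{n-k})\|\nabla\Psi^{n,k}\|_{L^2(\Omega)}^2+\frac1{2\gamma}\,b_{n-1}\|\nabla\Psi^{n,0}\|_{L^2(\Omega)}^2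 .$$ **Theorem.** If $S\ge L/2$, then $\widetilde E(u^n)\le\widetilde E(u^{n-1})$ for all $1\le n\le N$. -/

import Mathlib

namespace TFCH

open MeasureTheory Filter Topology
open scoped ContDiff

noncomputable section

/-- The Euclidean space `ℝᵈ`. -/
abbrev Space (d : ℕ) := EuclideanSpace ℝ (Fin d)

/-- Test functions: smooth functions with compact support contained in `Ω`. -/
def IsTestFunction {d : ℕ} (Ω : Set (Space d)) (φ : Space d → ℝ) : Prop :=
  ContDiff ℝ ∞ φ ∧ HasCompactSupport φ ∧ tsupport φ ⊆ Ω

/-- An element of `H¹(Ω)`: a function in `L²(Ω)` together with its weak gradient in `L²(Ω)`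
(the weak gradient is unique almost everywhere on `Ω`). -/
structure H1Function {d : ℕ} (Ω : Set (Space d)) where
  /-- the function -/
  toFun : Space d → ℝ
  /-- its weak gradient -/
  grad : Space d → Space d
  memLp_toFun : MemLp toFun 2 (volume.restrict Ω)
  memLp_grad : MemLp grad 2 (volume.restrict Ω)
  weak_grad : ∀ φ : Space d → ℝ, IsTestFunction Ω φ → ∀ i : Fin d,
    ∫ x in Ω, toFun x * fderiv ℝ φ x (EuclideanSpace.single i 1) = - ∫ x in Ω, grad x i * φ x

/-- `u ∈ H₀¹(Ω)`, the closure of the test functions in `H¹(Ω)`. -/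
def IsH10 {d : ℕ} {Ω : Set (Space d)} (u : H1Function Ω) : Prop :=
  ∃ φ : ℕ → Space d → ℝ, (∀ m, IsTestFunction Ω (φ m)) ∧
    Tendsto (fun m => (∫ x in Ω, (u.toFun x - φ m x) ^ 2) +
      ∫ x in Ω, ‖u.grad x - gradient (φ m) x‖ ^ 2) atTop (𝓝 0)

/-- `u ∈ H¹_per` for the periods `ℓ`, where `Ω` is the open period cell: the function and its
gradient satisfy the weak derivative identity against all smooth periodic functions. -/
def IsH1Periodic {d : ℕ} {Ω : Set (Space d)} (ℓ : Fin d → ℝ) (u : H1Function Ω) : Prop :=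
  ∀ φ : Space d → ℝ, ContDiff ℝ ∞ φ →
    (∀ (i : Fin d) (x : Space d), φ (x + EuclideanSpace.single i (ℓ i)) = φ x) → ∀ i : Fin d,
    ∫ x in Ω, u.toFun x * fderiv ℝ φ x (EuclideanSpace.single i 1) =
      - ∫ x in Ω, u.grad x i * φ x

/-- The boundary conditions: homogeneous Dirichlet, homogeneous Neumann, and periodic with
period `ℓ i` in the `i`-th coordinate. -/
inductive BoundaryCondition (d : ℕ) where
  | dirichlet : BoundaryCondition d
  | neumann : BoundaryCondition d
  | periodic (ℓ : Fin d → ℝ) : BoundaryCondition d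

/-- Periodic conditions are posed on the box `∏ᵢ (0, ℓ i)`. -/
def BoundaryCondition.Admissible {d : ℕ} (bc : BoundaryCondition d) (Ω : Set (Space d)) : Prop :=
  match bc with
  | .dirichlet => True
  | .neumann => True
  | .periodic ℓ => (∀ i, 0 < ℓ i) ∧ Ω = {x | ∀ i, 0 < x i ∧ x i < ℓ i}

/-- The energy space `V` of a boundary condition: `H₀¹(Ω)` for Dirichlet, `H¹(Ω)` for Neumann
(a natural condition, encoded in the weak formulation), `H¹_per` for periodic. -/
def BoundaryCondition.Mem {d : ℕ} {Ω : Set (Space d)} (bc : BoundaryCondition d)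
    (u : H1Function Ω) : Prop :=
  match bc with
  | .dirichlet => IsH10 u
  | .neumann => True
  | .periodic ℓ => IsH1Periodic ℓ u

/-- `-ΔΨ = g` in `Ω` with the given boundary condition, in the weak sense. -/
def IsPoissonSolution {d : ℕ} {Ω : Set (Space d)} (bc : BoundaryCondition d)
    (Ψ : H1Function Ω) (g : Space d → ℝ) : Prop :=
  bc.Mem Ψ ∧ ∀ φ : H1Function Ω, bc.Mem φ →
    ∫ x in Ω, inner ℝ (Ψ.grad x) (φ.grad x) = ∫ x in Ω, g x * φ.toFun x

/-- The truncated double-well potential. -/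
def truncPotential (M s : ℝ) : ℝ :=
  if M ≤ s then
    1 / 2 * (3 * M ^ 2 - 1) * (s - M) ^ 2 + (M ^ 3 - M) * (s - M) + 1 / 4 * (M ^ 2 - 1) ^ 2
  else if s ≤ -M then
    1 / 2 * (3 * M ^ 2 - 1) * (s + M) ^ 2 - (M ^ 3 - M) * (s + M) + 1 / 4 * (M ^ 2 - 1) ^ 2
  else 1 / 4 * (s ^ 2 - 1) ^ 2

/-- The truncated force, the derivative of the truncated potential. -/
def truncForce (M s : ℝ) : ℝ := deriv (truncPotential M) s

/-- The coefficients `b_k` of the L1 approximation with time step `τ`. -/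
def l1Coeff (α τ : ℝ) (k : ℕ) : ℝ :=
  1 / (Real.Gamma (2 - α) * τ ^ α) * (((k : ℝ) + 1) ^ (1 - α) - (k : ℝ) ^ (1 - α))

/-- The L1 approximation `∑_{k=1}^n b_{n-k} (u^k - u^{k-1})` of the Caputo derivative. -/
def l1Deriv {d : ℕ} {Ω : Set (Space d)} (α τ : ℝ) (u : ℕ → H1Function Ω) (n : ℕ)
    (x : Space d) : ℝ :=
  ∑ k ∈ Finset.Icc 1 n, l1Coeff α τ (n - k) * ((u k).toFun x - (u (k - 1)).toFun x)

/-- `u⁰, …, u^N` solves the semidiscrete stabilized L1-IMEX scheme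
`∂̄ₜ^α uⁿ = γ Δ wⁿ`, `wⁿ = -ε² Δ uⁿ + f̃(uⁿ⁻¹) + S (uⁿ - uⁿ⁻¹)` for `1 ≤ n ≤ N`, in the weak
sense, with the boundary condition imposed on `uⁿ` and on the chemical potential `wⁿ`. -/
structure IsL1ImexSolution {d : ℕ} {Ω : Set (Space d)} (bc : BoundaryCondition d)
    (α τ γ ε M S : ℝ) (N : ℕ) (u : ℕ → H1Function Ω) : Prop where
  boundary : ∀ n, n ≤ N → bc.Mem (u n)
  step : ∀ n, 1 ≤ n → n ≤ N → ∃ w : H1Function Ω, bc.Mem w ∧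
    (∀ φ : H1Function Ω, bc.Mem φ →
      ∫ x in Ω, l1Deriv α τ u n x * φ.toFun x =
        -(γ * ∫ x in Ω, inner ℝ (w.grad x) (φ.grad x))) ∧
    (∀ φ : H1Function Ω, bc.Mem φ →
      ∫ x in Ω, w.toFun x * φ.toFun x =
        ε ^ 2 * (∫ x in Ω, inner ℝ ((u n).grad x) (φ.grad x)) +
        ∫ x in Ω, (truncForce M ((u (n - 1)).toFun x) +
          S * ((u n).toFun x - (u (n - 1)).toFun x)) * φ.toFun x)

/-- The Ginzburg-Landau energy, with the truncated potential. -/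
def energy {d : ℕ} {Ω : Set (Space d)} (ε M : ℝ) (u : H1Function Ω) : ℝ :=
  ∫ x in Ω, (ε ^ 2 / 2 * ‖u.grad x‖ ^ 2 + truncPotential M (u.toFun x))

/-- `‖∇Ψ‖²` in `L²(Ω)`. -/
def gradNormSq {d : ℕ} {Ω : Set (Space d)} (Ψ : H1Function Ω) : ℝ :=
  ∫ x in Ω, ‖Ψ.grad x‖ ^ 2

/-- The discrete modified energy at level `n`; at `n = 0` it is the energy of `u⁰`. -/
def modifiedEnergy {d : ℕ} {Ω : Set (Space d)} (α τ γ ε M : ℝ) (u : ℕ → H1Function Ω)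
    (Ψ : ℕ → ℕ → H1Function Ω) (n : ℕ) : ℝ :=
  if n = 0 then energy ε M (u 0)
  else energy ε M (u n) +
    1 / (2 * γ) * (∑ k ∈ Finset.Icc 1 (n - 1),
      (l1Coeff α τ (n - k - 1) - l1Coeff α τ (n - k)) * gradNormSq (Ψ n k)) +
    1 / (2 * γ) * l1Coeff α τ (n - 1) * gradNormSq (Ψ n 0)

end

end TFCH

namespace TFCH

open MeasureTheory Filter Topology
open scoped ContDiff

/-! Test the evolution equation with `Ψ n (n-1)`, the chemical potential equation with `uⁿ - uⁿ⁻¹`,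
and the Poisson problem of `Ψ n (n-1)` with `wⁿ`. Since `F̃'' ≤ L`, stabilization by `S ≥ L/2`
absorbs the explicit treatment of `f̃`, so `E(uⁿ) - E(uⁿ⁻¹) ≤ ⟨wⁿ, uⁿ - uⁿ⁻¹⟩` (`energy_sub_le`).
With `D k = ∇Ψ n k`, the right side equals `-(1/γ) ∑ b_{n-k} ⟨D (k-1) - D k, D (n-1)⟩`
(`energy_step_le`).

It remains to bound this sum in a Hilbert space (`history_le_succ`). Abel summation and polarization
split it into the new history `‖D k‖²`, the old history `‖D k - D (n-1)‖²`, and a nonnegative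
remainder. The weights compare in the right direction because `b` is nonnegative, nonincreasing and
convex. The old history is the one at level `n-1` because `Ψ n k - Ψ n (n-1)` and `Ψ (n-1) k` solve
the same Poisson problem (`norm_der_eq_of_isPoissonSolution`). -/

/-! ### The truncated double well. -/

/-- The projection of the real line onto `[-M, M]`. -/
noncomputable def clamp (M s : ℝ) : ℝ := max (-M) (min s M)

lemma abs_clamp_le {M : ℝ} (hM : 0 ≤ M) (s : ℝ) : |clamp M s| ≤ M := by
  rw [abs_le]
  exact ⟨le_max_left _ _, max_le (by linarith) (min_le_right _ _)⟩

lemma clamp_cases {M : ℝ} (hM : 0 ≤ M) (s : ℝ) :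
    (M ≤ s ∧ clamp M s = M) ∨ (s ≤ -M ∧ clamp M s = -M) ∨
      (-M ≤ s ∧ s ≤ M ∧ clamp M s = s) := by
  unfold clamp
  rcases le_total M s with h | h
  · exact Or.inl ⟨h, by rw [min_eq_right h, max_eq_right (by linarith)]⟩
  · rcases le_total s (-M) with h' | h'
    · exact Or.inr (Or.inl ⟨h', by rw [min_eq_left h, max_eq_left h']⟩)
    · exact Or.inr (Or.inr ⟨h', h, by rw [min_eq_left h, max_eq_right h']⟩)

lemma abs_clamp_le_abs {M : ℝ} (hM : 0 ≤ M) (s : ℝ) : |clamp M s| ≤ |s| := by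
  rcases clamp_cases hM s with ⟨h, e⟩ | ⟨h, e⟩ | ⟨-, -, e⟩ <;> rw [e]
  · rw [abs_of_nonneg hM]; exact h.trans (le_abs_self s)
  · rw [abs_neg, abs_of_nonneg hM]; linarith [neg_le_abs s]

/-- Expansion about the clamped point with second derivative `3M² - 1`: inside `[-M, M]` the
increment is zero, outside the base point is `±M`. One formula thus replaces the three branches. -/
lemma truncPotential_eq_clamp {M : ℝ} (hM : 0 ≤ M) (s : ℝ) :
    truncPotential M s = 1 / 4 * (clamp M s ^ 2 - 1) ^ 2 +
      (clamp M s ^ 3 - clamp M s) * (s - clamp M s) +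
      (3 * M ^ 2 - 1) / 2 * (s - clamp M s) ^ 2 := by
  unfold truncPotential
  rcases clamp_cases hM s with ⟨h, e⟩ | ⟨h, e⟩ | ⟨h, h', e⟩ <;> rw [e]
  · rw [if_pos h]; ring
  · split_ifs with h1
    · obtain rfl : M = 0 := by linarith
      obtain rfl : s = 0 := by linarith
      ring
    · ring
  · split_ifs with h1 h2
    · obtain rfl : M = s := le_antisymm h1 h'
      ring
    · obtain rfl : s = -M := le_antisymm h2 h
      ring
    · ring

/-- The truncated force in closed form. -/
noncomputable def clampForce (M s : ℝ) : ℝ :=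
  clamp M s ^ 3 - clamp M s + (3 * M ^ 2 - 1) * (s - clamp M s)

lemma cubic_mono {M x y : ℝ} (hx : |x| ≤ M) (hy : |y| ≤ M) (h : x ≤ y) :
    3 * M ^ 2 * x - x ^ 3 ≤ 3 * M ^ 2 * y - y ^ 3 := by
  have hx2 : x ^ 2 ≤ M ^ 2 := sq_le_sq' (abs_le.1 hx).1 (abs_le.1 hx).2
  have hy2 : y ^ 2 ≤ M ^ 2 := sq_le_sq' (abs_le.1 hy).1 (abs_le.1 hy).2
  nlinarith [mul_nonneg (sub_nonneg.2 h)
    (show 0 ≤ 3 * M ^ 2 - (x ^ 2 + x * y + y ^ 2) by nlinarith [sq_nonneg (x - y)])]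

/-- The function `G(s) = (3M² - 1)s²/2 - F̃(s)` is convex, with derivative `q(x) = 3M²x - x³` at `x
= clamp M s`. The gap between the two sides is its Bregman divergence, split at `y = clamp M b`: the
part beyond the clamp is `key`, the part between `x = clamp M a` and `y` is a square times a
nonnegative factor. -/
lemma truncPotential_sub_le {M : ℝ} (hM : 0 ≤ M) (a b : ℝ) :
    truncPotential M b - truncPotential M a ≤
      clampForce M a * (b - a) + (3 * M ^ 2 - 1) / 2 * (b - a) ^ 2 := by
  rw [truncPotential_eq_clamp hM, truncPotential_eq_clamp hM, clampForce]
  have hx := abs_clamp_le hM a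
  have hy := abs_clamp_le hM b
  have key : 0 ≤ (b - clamp M b) * ((3 * M ^ 2 * clamp M b - clamp M b ^ 3) -
      (3 * M ^ 2 * clamp M a - clamp M a ^ 3)) := by
    rcases clamp_cases hM b with ⟨h, e⟩ | ⟨h, e⟩ | ⟨-, -, e⟩
    · exact mul_nonneg (by linarith)
        (sub_nonneg.2 (cubic_mono hx hy (by rw [e]; exact (abs_le.1 hx).2)))
    · exact mul_nonneg_of_nonpos_of_nonpos (by linarith)
        (sub_nonpos.2 (cubic_mono hy hx (by rw [e]; exact (abs_le.1 hx).1)))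
    · simp [e]
  generalize clamp M a = x at *
  generalize clamp M b = y at *
  have hx2 : x ^ 2 ≤ M ^ 2 := sq_le_sq' (abs_le.1 hx).1 (abs_le.1 hx).2
  have hy2 : y ^ 2 ≤ M ^ 2 := sq_le_sq' (abs_le.1 hy).1 (abs_le.1 hy).2
  have : 0 ≤ (y - x) ^ 2 * (3 / 2 * M ^ 2 - 1 / 4 * (y ^ 2 + 2 * x * y + 3 * x ^ 2)) :=
    mul_nonneg (sq_nonneg _) (by nlinarith [sq_nonneg (x - y)])
  linarith

/-- Integrated form of `F̃'' ≥ -1`; it supplies the lower bound in the differentiability proof. -/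
lemma clampForce_sub_mul_ge {M : ℝ} (hM : 0 ≤ M) (a b : ℝ) :
    -(b - a) ^ 2 ≤ (clampForce M b - clampForce M a) * (b - a) := by
  have hcl : |clamp M b - clamp M a| ≤ |b - a| := by
    have h1 : |min b M - min a M| ≤ |b - a| := abs_inf_sub_inf_le_abs b a M
    have h2 := abs_sup_sub_sup_le_abs (min b M) (min a M) (-M)
    unfold clamp
    rw [max_comm (-M), max_comm (-M)]
    exact h2.trans h1
  have hx := abs_clamp_le hM a
  have hy := abs_clamp_le hM b
  unfold clampForce
  generalize clamp M a = x at *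
  generalize clamp M b = y at *
  have hx2 : x ^ 2 ≤ M ^ 2 := sq_le_sq' (abs_le.1 hx).1 (abs_le.1 hx).2
  have hy2 : y ^ 2 ≤ M ^ 2 := sq_le_sq' (abs_le.1 hy).1 (abs_le.1 hy).2
  have hprod : (y - x) * (b - a) ≤ (b - a) ^ 2 := by
    calc (y - x) * (b - a) ≤ |y - x| * |b - a| := by rw [← abs_mul]; exact le_abs_self _
      _ ≤ |b - a| * |b - a| := by gcongr
      _ = (b - a) ^ 2 := by rw [abs_mul_abs_self]; ring
  have hq0 : 0 ≤ 3 * M ^ 2 - (x ^ 2 + x * y + y ^ 2) := by nlinarith [sq_nonneg (x - y)]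
  have hq1 : 0 ≤ x ^ 2 + x * y + y ^ 2 := by nlinarith [sq_nonneg (x + y), sq_nonneg x, sq_nonneg y]
  have h1 := mul_le_mul_of_nonneg_right hprod hq0
  have h2 := mul_nonneg (sq_nonneg (b - a)) hq1
  nlinarith

/-- A two-sided quadratic error bound avoids any case distinction at `±M`: the upper bound is
`truncPotential_sub_le`, the lower one follows by exchanging `a` and `b` and moving the force from
`b` back to `a`. -/
lemma hasDerivAt_truncPotential {M : ℝ} (hM : 0 ≤ M) (a : ℝ) :
    HasDerivAt (truncPotential M) (clampForce M a) a := by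
  rw [hasDerivAt_iff_isLittleO]
  refine Asymptotics.IsBigO.trans_isLittleO (g := fun b => (b - a) ^ 2) ?_ ?_
  · refine Asymptotics.IsBigO.of_bound ((3 * M ^ 2 - 1) / 2 + 1 + 1) (Eventually.of_forall ?_)
    intro b
    have h1 := truncPotential_sub_le hM a b
    have h2 := truncPotential_sub_le hM b a
    have h3 := clampForce_sub_mul_ge hM a b
    rw [Real.norm_eq_abs, Real.norm_eq_abs, abs_of_nonneg (sq_nonneg (b - a)), abs_le, smul_eq_mul]
    have := sq_nonneg (b - a)
    constructor <;> nlinarith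
  · have : (fun b : ℝ => (b - a) ^ 2) = (fun b => (b - a) * (b - a)) := by ext; ring
    rw [this]
    have h0 : (fun b : ℝ => b - a) =o[𝓝 a] (fun _ => (1 : ℝ)) := by
      rw [Asymptotics.isLittleO_one_iff]
      have : Continuous fun b : ℝ => b - a := by fun_prop
      simpa using this.tendsto a
    simpa using h0.mul_isBigO (Asymptotics.isBigO_refl (fun b : ℝ => b - a) (𝓝 a))

lemma truncForce_eq {M : ℝ} (hM : 0 ≤ M) (s : ℝ) : truncForce M s = clampForce M s :=
  (hasDerivAt_truncPotential hM s).deriv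

lemma continuous_truncPotential {M : ℝ} (hM : 0 ≤ M) : Continuous (truncPotential M) :=
  continuous_iff_continuousAt.2 fun a => (hasDerivAt_truncPotential hM a).continuousAt

lemma continuous_truncForce {M : ℝ} (hM : 0 ≤ M) : Continuous (truncForce M) := by
  have : truncForce M = clampForce M := funext (truncForce_eq hM)
  rw [this]
  unfold clampForce clamp
  fun_prop

lemma abs_truncForce_le {M : ℝ} (hM : 1 ≤ M) (s : ℝ) :
    |truncForce M s| ≤ (6 * M ^ 2 - 1) * |s| := by
  have hM0 : 0 ≤ M := by linarith
  rw [truncForce_eq hM0]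
  have h1 := abs_clamp_le_abs hM0 s
  have h2 := abs_clamp_le hM0 s
  have e : clampForce M s = (3 * M ^ 2 - 1) * s - clamp M s * (3 * M ^ 2 - clamp M s ^ 2) := by
    unfold clampForce; ring
  rw [e]
  generalize clamp M s = x at *
  have hx2 : x ^ 2 ≤ M ^ 2 := sq_le_sq' (abs_le.1 h2).1 (abs_le.1 h2).2
  calc _ ≤ |(3 * M ^ 2 - 1) * s| + |x * (3 * M ^ 2 - x ^ 2)| := abs_sub _ _
    _ = (3 * M ^ 2 - 1) * |s| + |x| * (3 * M ^ 2 - x ^ 2) := by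
        rw [abs_mul, abs_mul, abs_of_nonneg (show 0 ≤ 3 * M ^ 2 - 1 by nlinarith),
          abs_of_nonneg (show 0 ≤ 3 * M ^ 2 - x ^ 2 by nlinarith)]
    _ ≤ (3 * M ^ 2 - 1) * |s| + |s| * (3 * M ^ 2) := by
        gcongr
        · nlinarith
        · nlinarith [sq_nonneg x]
    _ = _ := by ring

lemma truncPotential_nonneg {M : ℝ} (hM : 1 ≤ M) (s : ℝ) : 0 ≤ truncPotential M s := by
  have h1 : 0 ≤ M ^ 3 - M := by nlinarith [mul_nonneg (sub_nonneg.2 hM) (sub_nonneg.2 hM)]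
  have h2 : 0 ≤ 3 * M ^ 2 - 1 := by nlinarith
  unfold truncPotential
  split_ifs with h h'
  · have := mul_nonneg h1 (sub_nonneg.2 h); positivity
  · have := mul_nonneg h1 (show 0 ≤ -(s + M) by linarith)
    have h3 : 0 ≤ 1 / 2 * (3 * M ^ 2 - 1) * (s + M) ^ 2 := by positivity
    have h4 : 0 ≤ 1 / 4 * (M ^ 2 - 1) ^ 2 := by positivity
    linarith
  · positivity

lemma truncPotential_le {M : ℝ} (hM : 1 ≤ M) (s : ℝ) :
    truncPotential M s ≤ 1 / 4 + (3 * M ^ 2 - 1) / 2 * s ^ 2 := by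
  have h := truncPotential_sub_le (by linarith : 0 ≤ M) 0 s
  have hc : clamp M 0 = 0 := by
    have := abs_clamp_le_abs (by linarith : 0 ≤ M) 0
    simpa using this
  have h0 : truncPotential M 0 = 1 / 4 := by
    rw [truncPotential_eq_clamp (by linarith : 0 ≤ M), hc]; norm_num
  have hf : clampForce M 0 = 0 := by simp [clampForce, hc]
  rw [h0, hf] at h
  simp only [zero_mul, sub_zero, zero_add] at h
  linarith

/-! ### Sign, monotonicity and convexity of the L1 coefficients. -/

lemma convexOn_rpow_succ_sub {α : ℝ} (hα0 : 0 < α) (hα1 : α < 1) :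
    ConvexOn ℝ (Set.Ici 0) (fun x : ℝ => (x + 1) ^ (1 - α) - x ^ (1 - α)) := by
  have hd : ∀ x : ℝ, 0 < x → HasDerivAt (fun x : ℝ => (x + 1) ^ (1 - α) - x ^ (1 - α))
      ((1 - α) * ((x + 1) ^ (-α) - x ^ (-α))) x := by
    intro x hx
    have h1 := ((hasDerivAt_id x).add_const 1).rpow_const (p := 1 - α)
      (Or.inl (by simp only [id]; linarith))
    have h2 := (hasDerivAt_id x).rpow_const (p := 1 - α) (Or.inl hx.ne')
    refine (h1.sub h2).congr_deriv ?_
    simp only [id, show 1 - α - 1 = -α by ring]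
    ring
  have hd2 : ∀ x : ℝ, 0 < x → HasDerivAt (fun x : ℝ => (1 - α) * ((x + 1) ^ (-α) - x ^ (-α)))
      ((1 - α) * (α * (x ^ (-α - 1) - (x + 1) ^ (-α - 1)))) x := by
    intro x hx
    have h1 := ((hasDerivAt_id x).add_const 1).rpow_const (p := -α)
      (Or.inl (by simp only [id]; linarith))
    have h2 := (hasDerivAt_id x).rpow_const (p := -α) (Or.inl hx.ne')
    refine ((h1.sub h2).const_mul (1 - α)).congr_deriv ?_
    simp only [id]
    ring
  refine convexOn_of_hasDerivWithinAt2_nonneg (convex_Ici 0) ?_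
    (f' := fun x : ℝ => (1 - α) * ((x + 1) ^ (-α) - x ^ (-α)))
    (f'' := fun x : ℝ => (1 - α) * (α * (x ^ (-α - 1) - (x + 1) ^ (-α - 1)))) ?_ ?_ ?_
  · refine ContinuousOn.sub ?_ ?_
    · exact (continuousOn_id.add continuousOn_const).rpow_const fun x _ => Or.inr (by linarith)
    · exact continuousOn_id.rpow_const fun x _ => Or.inr (by linarith)
  · intro x hx
    rw [interior_Ici] at hx
    exact (hd x hx).hasDerivWithinAt
  · intro x hx
    rw [interior_Ici] at hx
    exact (hd2 x hx).hasDerivWithinAt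
  · intro x hx
    rw [interior_Ici] at hx
    have hx : 0 < x := hx
    have := Real.rpow_le_rpow_of_nonpos hx (by linarith : x ≤ x + 1) (by linarith : -α - 1 ≤ 0)
    exact mul_nonneg (by linarith) (mul_nonneg hα0.le (by linarith))

section L1Coeff

variable {α τ : ℝ}

lemma l1Coeff_const_nonneg (hα1 : α < 1) (hτ : 0 < τ) :
    0 ≤ 1 / (Real.Gamma (2 - α) * τ ^ α) := by
  have := Real.Gamma_pos_of_pos (by linarith : 0 < 2 - α)
  positivity

lemma l1Coeff_nonneg (hα1 : α < 1) (hτ : 0 < τ) (k : ℕ) : 0 ≤ l1Coeff α τ k := by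
  refine mul_nonneg (l1Coeff_const_nonneg hα1 hτ) (sub_nonneg.2 ?_)
  exact Real.rpow_le_rpow k.cast_nonneg (by linarith) (by linarith)

lemma l1Coeff_convex (hα0 : 0 < α) (hα1 : α < 1) (hτ : 0 < τ) (k : ℕ) :
    2 * l1Coeff α τ (k + 1) ≤ l1Coeff α τ k + l1Coeff α τ (k + 2) := by
  have h := (convexOn_rpow_succ_sub hα0 hα1).2 (x := (k : ℝ)) (y := (k : ℝ) + 2)
    (Set.mem_Ici.2 k.cast_nonneg) (by simp only [Set.mem_Ici]; positivity)
    (by norm_num : (0 : ℝ) ≤ 1 / 2) (by norm_num : (0 : ℝ) ≤ 1 / 2) (by norm_num)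
  simp only [smul_eq_mul] at h
  rw [show 1 / 2 * (k : ℝ) + 1 / 2 * ((k : ℝ) + 2) = (k : ℝ) + 1 by ring] at h
  have := mul_le_mul_of_nonneg_left h (l1Coeff_const_nonneg hα1 hτ)
  unfold l1Coeff
  push_cast
  linarith

lemma l1Coeff_succ_le (hα0 : 0 < α) (hα1 : α < 1) (hτ : 0 < τ) (k : ℕ) :
    l1Coeff α τ (k + 1) ≤ l1Coeff α τ k := by
  refine mul_le_mul_of_nonneg_left ?_ (l1Coeff_const_nonneg hα1 hτ)
  have h := (Real.concaveOn_rpow (by linarith : 0 ≤ 1 - α) (by linarith : 1 - α ≤ 1)).2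
    (x := (k : ℝ)) (y := (k : ℝ) + 2)
    (Set.mem_Ici.2 k.cast_nonneg) (by simp only [Set.mem_Ici]; positivity)
    (by norm_num : (0 : ℝ) ≤ 1 / 2) (by norm_num : (0 : ℝ) ≤ 1 / 2) (by norm_num)
  simp only [smul_eq_mul] at h
  rw [show 1 / 2 * (k : ℝ) + 1 / 2 * ((k : ℝ) + 2) = (k : ℝ) + 1 by ring] at h
  push_cast
  rw [show (k : ℝ) + 1 + 1 = k + 2 by ring]
  linarith

end L1Coeff

/-! ### Summation by parts and the history inequality. -/

/-- Abel summation. The upper limit is decoupled from `n` so that induction leaves the weights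
fixed. -/
lemma sum_mul_sub_eq (b a : ℕ → ℝ) (n j : ℕ) :
    ∑ k ∈ Finset.Icc 1 (j + 1), b (n - k) * (a (k - 1) - a k) =
      b (n - 1) * a 0 - b (n - (j + 1)) * a (j + 1) +
        ∑ k ∈ Finset.Icc 1 j, (b (n - k - 1) - b (n - k)) * a k := by
  induction j with
  | zero => simp; ring
  | succ j ih =>
    rw [Finset.sum_Icc_succ_top (by omega), ih, Finset.sum_Icc_succ_top (by omega)]
    simp only [Nat.add_sub_cancel, Nat.sub_sub]
    ring

lemma sum_sub_eq (b : ℕ → ℝ) (n j : ℕ) :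
    ∑ k ∈ Finset.Icc 1 j, (b (n - k - 1) - b (n - k)) = b (n - (j + 1)) - b (n - 1) := by
  induction j with
  | zero => simp
  | succ j ih =>
    rw [Finset.sum_Icc_succ_top (by omega), ih]
    simp only [Nat.sub_sub]
    ring

lemma history_le_zero {H : Type*} [NormedAddCommGroup H] [InnerProductSpace ℝ H]
    (b : ℕ → ℝ) (hb : 0 ≤ b 0) (D : ℕ → H) (hD : D 1 = 0) :
    b 0 * ‖D 0‖ ^ 2 ≤
      2 * ∑ k ∈ Finset.Icc 1 1, b (1 - k) * inner ℝ (D (k - 1) - D k) (D 0) := by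
  simp only [Finset.Icc_self, Finset.sum_singleton, Nat.sub_self, hD, sub_zero,
    real_inner_self_eq_norm_sq]
  have := mul_nonneg hb (sq_nonneg ‖D 0‖)
  linarith

/-- After Abel summation and polarization against `p = D (m + 1)`, the coefficients of `‖p‖²`
telescope to `b 0 ≥ 0`. Convexity of `b` compares the weights for `1 ≤ k ≤ m`, monotonicity those
for `k = 0`. -/
lemma history_le_succ {H : Type*} [NormedAddCommGroup H] [InnerProductSpace ℝ H]
    (b : ℕ → ℝ) (hb : ∀ k, 0 ≤ b k) (hanti : ∀ k, b (k + 1) ≤ b k)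
    (hconv : ∀ k, 2 * b (k + 1) ≤ b k + b (k + 2)) (D : ℕ → H) (m : ℕ) (hD : D (m + 2) = 0) :
    (∑ k ∈ Finset.Icc 1 (m + 1), (b (m + 2 - k - 1) - b (m + 2 - k)) * ‖D k‖ ^ 2) +
        b (m + 1) * ‖D 0‖ ^ 2 ≤
      (∑ k ∈ Finset.Icc 1 m, (b (m + 1 - k - 1) - b (m + 1 - k)) * ‖D k - D (m + 1)‖ ^ 2) +
        b m * ‖D 0 - D (m + 1)‖ ^ 2 +
      2 * ∑ k ∈ Finset.Icc 1 (m + 2), b (m + 2 - k) * inner ℝ (D (k - 1) - D k) (D (m + 1)) := by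
  set p := D (m + 1) with hp
  have habel : ∑ k ∈ Finset.Icc 1 (m + 2), b (m + 2 - k) * inner ℝ (D (k - 1) - D k) p =
      b (m + 1) * inner ℝ (D 0) p +
        ∑ k ∈ Finset.Icc 1 (m + 1), (b (m + 2 - k - 1) - b (m + 2 - k)) * inner ℝ (D k) p := by
    have := sum_mul_sub_eq b (fun k => inner ℝ (D k) p) (m + 2) (m + 1)
    simp only [show m + 1 + 1 = m + 2 from rfl, hD, inner_zero_left, mul_zero, sub_zero] at this
    simp only [inner_sub_left]
    exact this
  have hpol : ∀ x : H, 2 * inner ℝ x p = ‖x‖ ^ 2 + ‖p‖ ^ 2 - ‖x - p‖ ^ 2 := by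
    intro x; rw [norm_sub_sq_real]; ring
  have hsum : 2 * ∑ k ∈ Finset.Icc 1 (m + 1),
        (b (m + 2 - k - 1) - b (m + 2 - k)) * inner ℝ (D k) p =
      (∑ k ∈ Finset.Icc 1 (m + 1), (b (m + 2 - k - 1) - b (m + 2 - k)) * ‖D k‖ ^ 2) +
      (b 0 - b (m + 1)) * ‖p‖ ^ 2 -
      ∑ k ∈ Finset.Icc 1 (m + 1), (b (m + 2 - k - 1) - b (m + 2 - k)) * ‖D k - p‖ ^ 2 := by
    have := sum_sub_eq b (m + 2) (m + 1)
    simp only [show m + 1 + 1 = m + 2 from rfl, Nat.sub_self,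
      show m + 2 - 1 = m + 1 from rfl] at this
    rw [← this, Finset.sum_mul, ← Finset.sum_add_distrib, ← Finset.sum_sub_distrib,
      Finset.mul_sum]
    refine Finset.sum_congr rfl fun k _ => ?_
    rw [mul_left_comm, hpol]; ring
  have htop : ∑ k ∈ Finset.Icc 1 (m + 1),
        (b (m + 2 - k - 1) - b (m + 2 - k)) * ‖D k - p‖ ^ 2 ≤
      ∑ k ∈ Finset.Icc 1 m, (b (m + 1 - k - 1) - b (m + 1 - k)) * ‖D k - p‖ ^ 2 := by
    -- The term `k = m + 1`, absent from the old history, vanishes since `D (m + 1) = p`.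
    rw [Finset.sum_Icc_succ_top (by omega), ← hp, sub_self, norm_zero]
    simp only [ne_eq, OfNat.ofNat_ne_zero, not_false_eq_true, zero_pow, mul_zero, add_zero]
    refine Finset.sum_le_sum fun k hk => mul_le_mul_of_nonneg_right ?_ (sq_nonneg _)
    rw [Finset.mem_Icc] at hk
    obtain ⟨j, rfl⟩ := Nat.exists_eq_add_of_le hk.2
    have := hconv j
    rw [show k + j + 2 - k - 1 = j + 1 by omega, show k + j + 2 - k = j + 2 by omega,
      show k + j + 1 - k - 1 = j by omega, show k + j + 1 - k = j + 1 by omega]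
    linarith
  have h0 := mul_nonneg (hb 0) (sq_nonneg ‖p‖)
  have h1 := mul_le_mul_of_nonneg_right (hanti m) (sq_nonneg ‖D 0 - p‖)
  have h2 : 2 * (b (m + 1) * inner ℝ (D 0) p) =
      b (m + 1) * (‖D 0‖ ^ 2 + ‖p‖ ^ 2 - ‖D 0 - p‖ ^ 2) := by
    rw [mul_left_comm, hpol]
  rw [habel, mul_add, h2, hsum]
  linarith

/-! ### Differences in the energy spaces. -/

lemma memLp_of_continuous_of_isBounded {d : ℕ} {F : Type*} [NormedAddCommGroup F]
    [SecondCountableTopologyEither (Space d) F] {Ω : Set (Space d)}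
    (hΩb : Bornology.IsBounded Ω) {g : Space d → F} (hg : Continuous g) :
    MemLp g 2 (volume.restrict Ω) := by
  have hK : IsCompact (closure Ω) := hΩb.isCompact_closure
  refine MemLp.mono_measure (Measure.restrict_mono subset_closure le_rfl) ?_
  have : IsFiniteMeasure (volume.restrict (closure Ω)) := ⟨by simpa using hK.measure_lt_top⟩
  obtain ⟨C, hC⟩ := hK.exists_bound_of_continuousOn hg.continuousOn
  exact MemLp.of_bound hg.aestronglyMeasurable C
    (ae_restrict_of_forall_mem hK.measurableSet hC)

lemma integrable_mul_of_memLp_two {X : Type*} [MeasurableSpace X] {μ : Measure X} {f g : X → ℝ}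
    (hf : MemLp f 2 μ) (hg : MemLp g 2 μ) : Integrable (fun x => f x * g x) μ :=
  hf.integrable_mul hg

lemma memLp_coord {X : Type*} [MeasurableSpace X] {μ : Measure X} {d : ℕ}
    {f : X → Space d} (hf : MemLp f 2 μ) (i : Fin d) : MemLp (fun x => f x i) 2 μ :=
  (EuclideanSpace.proj (𝕜 := ℝ) i).comp_memLp' hf

lemma continuous_fderiv_apply {d : ℕ} {φ : Space d → ℝ} (hφ : ContDiff ℝ ∞ φ) (v : Space d) :
    Continuous (fun x => fderiv ℝ φ x v) :=
  (hφ.continuous_fderiv (by simp)).clm_apply continuous_const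

lemma continuous_gradient {d : ℕ} {φ : Space d → ℝ} (hφ : ContDiff ℝ ∞ φ) :
    Continuous (gradient φ) :=
  (InnerProductSpace.toDual ℝ (Space d)).symm.continuous.comp (hφ.continuous_fderiv (by simp))

lemma gradient_sub_of_contDiff {d : ℕ} {φ ψ : Space d → ℝ} (hφ : ContDiff ℝ ∞ φ)
    (hψ : ContDiff ℝ ∞ ψ) (x : Space d) :
    gradient (fun y => φ y - ψ y) x = gradient φ x - gradient ψ x := by
  simp only [gradient]
  rw [fderiv_fun_sub (hφ.differentiable (by simp) x) (hψ.differentiable (by simp) x), map_sub]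

lemma IsTestFunction.sub {d : ℕ} {Ω : Set (Space d)} {φ ψ : Space d → ℝ}
    (hφ : IsTestFunction Ω φ) (hψ : IsTestFunction Ω ψ) :
    IsTestFunction Ω (fun x => φ x - ψ x) := by
  refine ⟨hφ.1.sub hψ.1, hφ.2.1.sub hψ.2.1, ?_⟩
  exact (tsupport_sub φ ψ).trans (Set.union_subset hφ.2.2 hψ.2.2)

/-- Stated for any smooth `φ`, so that it serves test functions and periodic functions alike;
boundedness of `Ω` makes the products integrable. -/
lemma weak_identity_sub {d : ℕ} {Ω : Set (Space d)} (hΩb : Bornology.IsBounded Ω)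
    (u v : H1Function Ω) {φ : Space d → ℝ} (hφ : ContDiff ℝ ∞ φ) (i : Fin d)
    (hu : ∫ x in Ω, u.toFun x * fderiv ℝ φ x (EuclideanSpace.single i 1) =
      - ∫ x in Ω, u.grad x i * φ x)
    (hv : ∫ x in Ω, v.toFun x * fderiv ℝ φ x (EuclideanSpace.single i 1) =
      - ∫ x in Ω, v.grad x i * φ x) :
    ∫ x in Ω, (u.toFun x - v.toFun x) * fderiv ℝ φ x (EuclideanSpace.single i 1) =
      - ∫ x in Ω, (u.grad x - v.grad x) i * φ x := by
  have h1 : MemLp φ 2 (volume.restrict Ω) :=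
    memLp_of_continuous_of_isBounded hΩb hφ.continuous
  have h2 := memLp_of_continuous_of_isBounded hΩb
    (continuous_fderiv_apply hφ (EuclideanSpace.single i 1))
  simp only [PiLp.sub_apply, sub_mul]
  rw [integral_sub (integrable_mul_of_memLp_two u.memLp_toFun h2)
      (integrable_mul_of_memLp_two v.memLp_toFun h2),
    integral_sub (integrable_mul_of_memLp_two (memLp_coord u.memLp_grad i) h1)
      (integrable_mul_of_memLp_two (memLp_coord v.memLp_grad i) h1), hu, hv]
  ring

/-- The difference of two elements of `H¹(Ω)`. -/
noncomputable def H1Function.sub {d : ℕ} {Ω : Set (Space d)} (hΩb : Bornology.IsBounded Ω)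
    (u v : H1Function Ω) : H1Function Ω where
  toFun x := u.toFun x - v.toFun x
  grad x := u.grad x - v.grad x
  memLp_toFun := u.memLp_toFun.sub v.memLp_toFun
  memLp_grad := u.memLp_grad.sub v.memLp_grad
  weak_grad φ hφ i :=
    weak_identity_sub hΩb u v hφ.1 i (u.weak_grad φ hφ i) (v.weak_grad φ hφ i)

lemma integral_norm_sub_sq_le {X F : Type*} [MeasurableSpace X] {μ : Measure X}
    [NormedAddCommGroup F] {f g : X → F} (hf : MemLp f 2 μ) (hg : MemLp g 2 μ) :
    ∫ x, ‖f x - g x‖ ^ 2 ∂μ ≤ 2 * ∫ x, ‖f x‖ ^ 2 ∂μ + 2 * ∫ x, ‖g x‖ ^ 2 ∂μ := by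
  have h1 := hf.norm.integrable_sq
  have h2 := hg.norm.integrable_sq
  rw [← integral_const_mul, ← integral_const_mul,
    ← integral_add (h1.const_mul 2) (h2.const_mul 2)]
  refine integral_mono (hf.sub hg).norm.integrable_sq
    ((h1.const_mul 2).add (h2.const_mul 2)) fun x => ?_
  have h := norm_sub_le (f x) (g x)
  have h' := norm_nonneg (f x - g x)
  nlinarith [sq_nonneg (‖f x‖ - ‖g x‖)]

lemma IsH10.sub {d : ℕ} {Ω : Set (Space d)} (hΩb : Bornology.IsBounded Ω)
    {u v : H1Function Ω} (hu : IsH10 u) (hv : IsH10 v) : IsH10 (u.sub hΩb v) := by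
  obtain ⟨φ, hφ, hφl⟩ := hu
  obtain ⟨ψ, hψ, hψl⟩ := hv
  refine ⟨fun m x => φ m x - ψ m x, fun m => (hφ m).sub (hψ m), ?_⟩
  have hlim := (hφl.const_mul 2).add (hψl.const_mul 2)
  simp only [mul_zero, add_zero] at hlim
  refine squeeze_zero (fun m => ?_) (fun m => ?_) hlim
  · exact add_nonneg (integral_nonneg fun x => sq_nonneg _) (integral_nonneg fun x => sq_nonneg _)
  · have h1 := integral_norm_sub_sq_le
      (u.memLp_toFun.sub (memLp_of_continuous_of_isBounded hΩb (hφ m).1.continuous))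
      (v.memLp_toFun.sub (memLp_of_continuous_of_isBounded hΩb (hψ m).1.continuous))
    have h2 := integral_norm_sub_sq_le
      (u.memLp_grad.sub (memLp_of_continuous_of_isBounded hΩb (continuous_gradient (hφ m).1)))
      (v.memLp_grad.sub (memLp_of_continuous_of_isBounded hΩb (continuous_gradient (hψ m).1)))
    simp only [Real.norm_eq_abs, sq_abs, Pi.sub_apply] at h1 h2
    simp only [H1Function.sub, gradient_sub_of_contDiff (hφ m).1 (hψ m).1]
    have e : ∀ x, u.grad x - v.grad x - (gradient (φ m) x - gradient (ψ m) x) =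
        u.grad x - gradient (φ m) x - (v.grad x - gradient (ψ m) x) :=
      fun x => sub_sub_sub_comm _ _ _ _
    simp only [sub_sub_sub_comm (u.toFun _), e]
    linarith

lemma BoundaryCondition.Mem.sub {d : ℕ} {Ω : Set (Space d)} (hΩb : Bornology.IsBounded Ω)
    {bc : BoundaryCondition d} {u v : H1Function Ω} (hu : bc.Mem u) (hv : bc.Mem v) :
    bc.Mem (u.sub hΩb v) := by
  cases bc with
  | dirichlet => exact IsH10.sub hΩb hu hv
  | neumann => trivial
  | periodic ℓ =>
    exact fun φ hφ hper i => weak_identity_sub hΩb u v hφ i (hu φ hφ hper i) (hv φ hφ hper i)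

/-! ### Weak formulations as inner products in `L²`. -/

/-- The class in `L²(Ω)` of an element of `H¹(Ω)`. -/
noncomputable def H1Function.val {d : ℕ} {Ω : Set (Space d)} (u : H1Function Ω) :
    Lp ℝ 2 (volume.restrict Ω) := u.memLp_toFun.toLp

/-- The class in `L²(Ω)` of the weak gradient of an element of `H¹(Ω)`. -/
noncomputable def H1Function.der {d : ℕ} {Ω : Set (Space d)} (u : H1Function Ω) :
    Lp (Space d) 2 (volume.restrict Ω) := u.memLp_grad.toLp

lemma inner_toLp_toLp {X F : Type*} [MeasurableSpace X] {μ : Measure X} [NormedAddCommGroup F]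
    [InnerProductSpace ℝ F] {f g : X → F} (hf : MemLp f 2 μ) (hg : MemLp g 2 μ) :
    inner ℝ hf.toLp hg.toLp = ∫ x, inner ℝ (f x) (g x) ∂μ := by
  rw [L2.inner_def]
  refine integral_congr_ae ?_
  filter_upwards [hf.coeFn_toLp, hg.coeFn_toLp] with x h1 h2
  rw [h1, h2]

lemma integral_mul_eq_inner {X : Type*} [MeasurableSpace X] {μ : Measure X} {f g : X → ℝ}
    (hf : MemLp f 2 μ) (hg : MemLp g 2 μ) :
    ∫ x, f x * g x ∂μ = inner ℝ hf.toLp hg.toLp := by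
  rw [inner_toLp_toLp]
  simp [mul_comm]

section

variable {d : ℕ} {Ω : Set (Space d)}

lemma H1Function.val_sub (hΩb : Bornology.IsBounded Ω) (u v : H1Function Ω) :
    (u.sub hΩb v).val = u.val - v.val := rfl

lemma H1Function.der_sub (hΩb : Bornology.IsBounded Ω) (u v : H1Function Ω) :
    (u.sub hΩb v).der = u.der - v.der := rfl

lemma integral_inner_grad (u v : H1Function Ω) :
    ∫ x in Ω, inner ℝ (u.grad x) (v.grad x) = inner ℝ u.der v.der :=
  (inner_toLp_toLp u.memLp_grad v.memLp_grad).symm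

lemma integral_toFun_mul (u v : H1Function Ω) :
    ∫ x in Ω, u.toFun x * v.toFun x = inner ℝ u.val v.val :=
  integral_mul_eq_inner u.memLp_toFun v.memLp_toFun

lemma integral_sub_toFun_mul (u v w : H1Function Ω) :
    ∫ x in Ω, (u.toFun x - v.toFun x) * w.toFun x = inner ℝ (u.val - v.val) w.val :=
  integral_mul_eq_inner (u.memLp_toFun.sub v.memLp_toFun) w.memLp_toFun

lemma gradNormSq_eq (u : H1Function Ω) : gradNormSq u = ‖u.der‖ ^ 2 := by
  rw [← real_inner_self_eq_norm_sq, ← integral_inner_grad]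
  simp [gradNormSq]

lemma integral_l1Deriv_mul (α τ : ℝ) (u : ℕ → H1Function Ω) (n : ℕ) (φ : H1Function Ω) :
    ∫ x in Ω, l1Deriv α τ u n x * φ.toFun x =
      ∑ k ∈ Finset.Icc 1 n,
        l1Coeff α τ (n - k) * inner ℝ ((u k).val - (u (k - 1)).val) φ.val := by
  simp only [l1Deriv, Finset.sum_mul, mul_assoc]
  rw [integral_finsetSum]
  · refine Finset.sum_congr rfl fun k _ => ?_
    rw [integral_const_mul, integral_sub_toFun_mul]
  · intro k _
    exact (integrable_mul_of_memLp_two ((u k).memLp_toFun.sub (u (k - 1)).memLp_toFun)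
      φ.memLp_toFun).const_mul _

lemma IsPoissonSolution.inner_der {bc : BoundaryCondition d} {Ψ a b : H1Function Ω}
    (h : IsPoissonSolution bc Ψ (fun x => a.toFun x - b.toFun x)) {φ : H1Function Ω}
    (hφ : bc.Mem φ) : inner ℝ Ψ.der φ.der = inner ℝ (a.val - b.val) φ.val := by
  rw [← integral_inner_grad, h.2 φ hφ, integral_sub_toFun_mul]

/-- By linearity `Ψ₁ - Ψ₂` and `Ψ₃` solve the same problem. Testing with each of them equates both
squared norms to the mixed product, without uniqueness of the solution. -/
lemma norm_der_eq_of_isPoissonSolution (hΩb : Bornology.IsBounded Ω) {bc : BoundaryCondition d}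
    {Ψ₁ Ψ₂ Ψ₃ a b c : H1Function Ω}
    (h₁ : IsPoissonSolution bc Ψ₁ (fun x => a.toFun x - b.toFun x))
    (h₂ : IsPoissonSolution bc Ψ₂ (fun x => a.toFun x - c.toFun x))
    (h₃ : IsPoissonSolution bc Ψ₃ (fun x => c.toFun x - b.toFun x)) :
    ‖Ψ₁.der - Ψ₂.der‖ ^ 2 = ‖Ψ₃.der‖ ^ 2 := by
  have key : ∀ φ : H1Function Ω, bc.Mem φ →
      inner ℝ (Ψ₁.der - Ψ₂.der) φ.der = inner ℝ Ψ₃.der φ.der := by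
    intro φ hφ
    rw [inner_sub_left, h₁.inner_der hφ, h₂.inner_der hφ, h₃.inner_der hφ, ← inner_sub_left,
      sub_sub_sub_cancel_left]
  have e1 := key _ (h₁.1.sub hΩb h₂.1)
  have e2 := key _ h₃.1
  rw [H1Function.der_sub] at e1
  rw [← real_inner_self_eq_norm_sq, ← real_inner_self_eq_norm_sq, e1, ← e2, real_inner_comm]

/-! ### Energy decay over one time step. -/

lemma memLp_truncForce {M : ℝ} (hM : 1 ≤ M) (u : H1Function Ω) :
    MemLp (fun x => truncForce M (u.toFun x)) 2 (volume.restrict Ω) := by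
  refine MemLp.of_le_mul (c := 6 * M ^ 2 - 1) u.memLp_toFun ?_ (Eventually.of_forall fun x => ?_)
  · exact (continuous_truncForce (by linarith)).comp_aestronglyMeasurable
      u.memLp_toFun.aestronglyMeasurable
  · exact abs_truncForce_le hM _

lemma integrable_truncPotential (hΩb : Bornology.IsBounded Ω) {M : ℝ} (hM : 1 ≤ M)
    (u : H1Function Ω) :
    Integrable (fun x => truncPotential M (u.toFun x)) (volume.restrict Ω) := by
  have : IsFiniteMeasure (volume.restrict Ω) := ⟨by simpa using hΩb.measure_lt_top⟩
  refine Integrable.mono' ((integrable_const (1 / 4 : ℝ)).add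
    (u.memLp_toFun.integrable_sq.const_mul ((3 * M ^ 2 - 1) / 2))) ?_
    (Eventually.of_forall fun x => ?_)
  · exact (continuous_truncPotential (by linarith)).comp_aestronglyMeasurable
      u.memLp_toFun.aestronglyMeasurable
  · rw [Real.norm_of_nonneg (truncPotential_nonneg hM _)]
    exact truncPotential_le hM _

lemma energy_eq (hΩb : Bornology.IsBounded Ω) (ε : ℝ) {M : ℝ} (hM : 1 ≤ M) (u : H1Function Ω) :
    energy ε M u = ε ^ 2 / 2 * ‖u.der‖ ^ 2 + ∫ x in Ω, truncPotential M (u.toFun x) := by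
  rw [energy, integral_add (u.memLp_grad.norm.integrable_sq.const_mul _)
    (integrable_truncPotential hΩb hM u), integral_const_mul, ← gradNormSq_eq, gradNormSq]

lemma integral_truncPotential_sub_le (hΩb : Bornology.IsBounded Ω) {M S : ℝ} (hM : 1 ≤ M)
    (hS : (3 * M ^ 2 - 1) / 2 ≤ S) (u v : H1Function Ω) :
    (∫ x in Ω, truncPotential M (u.toFun x)) - ∫ x in Ω, truncPotential M (v.toFun x) ≤
      ∫ x in Ω, (truncForce M (v.toFun x) + S * (u.toFun x - v.toFun x)) *
        (u.toFun x - v.toFun x) := by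
  have huv := u.memLp_toFun.sub v.memLp_toFun
  rw [← integral_sub (integrable_truncPotential hΩb hM u) (integrable_truncPotential hΩb hM v)]
  refine integral_mono
    ((integrable_truncPotential hΩb hM u).sub (integrable_truncPotential hΩb hM v))
    (integrable_mul_of_memLp_two ((memLp_truncForce hM v).add (huv.const_mul S)) huv) fun x => ?_
  have h := truncPotential_sub_le (by linarith : 0 ≤ M) (v.toFun x) (u.toFun x)
  have h2 := mul_le_mul_of_nonneg_right hS (sq_nonneg (u.toFun x - v.toFun x))
  simp only [truncForce_eq (by linarith : 0 ≤ M)]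
  linarith

lemma energy_sub_le (hΩb : Bornology.IsBounded Ω) {bc : BoundaryCondition d} {ε M S : ℝ}
    (hM : 1 ≤ M) (hS : (3 * M ^ 2 - 1) / 2 ≤ S) {u v w : H1Function Ω}
    (hu : bc.Mem u) (hv : bc.Mem v)
    (hw : ∀ φ : H1Function Ω, bc.Mem φ →
      ∫ x in Ω, w.toFun x * φ.toFun x =
        ε ^ 2 * (∫ x in Ω, inner ℝ (u.grad x) (φ.grad x)) +
        ∫ x in Ω, (truncForce M (v.toFun x) + S * (u.toFun x - v.toFun x)) * φ.toFun x) :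
    energy ε M u - energy ε M v ≤ inner ℝ w.val (u.val - v.val) := by
  have h := hw _ (hu.sub hΩb hv)
  rw [integral_toFun_mul, integral_inner_grad, H1Function.val_sub, H1Function.der_sub] at h
  have h2 := integral_truncPotential_sub_le hΩb hM hS u v
  have h3 : ‖v.der‖ ^ 2 - ‖u.der‖ ^ 2 + 2 * inner ℝ u.der (u.der - v.der) =
      ‖u.der - v.der‖ ^ 2 := by
    rw [norm_sub_sq_real, inner_sub_right, real_inner_self_eq_norm_sq]; ring
  -- The implicit gradient term leaves half of this quantity, which is discarded.
  have h4 := mul_nonneg (sq_nonneg ε) (sq_nonneg ‖u.der - v.der‖)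
  rw [h, energy_eq hΩb ε hM, energy_eq hΩb ε hM]
  rw [← h3] at h4
  simp only [H1Function.sub]
  linarith

end

section

variable {d : ℕ} {Ω : Set (Space d)}

lemma modifiedEnergy_zero (α τ γ ε M : ℝ) (u : ℕ → H1Function Ω) (Ψ : ℕ → ℕ → H1Function Ω) :
    modifiedEnergy α τ γ ε M u Ψ 0 = energy ε M (u 0) := if_pos rfl

lemma modifiedEnergy_succ (α τ γ ε M : ℝ) (u : ℕ → H1Function Ω) (Ψ : ℕ → ℕ → H1Function Ω)
    (n : ℕ) :
    modifiedEnergy α τ γ ε M u Ψ (n + 1) = energy ε M (u (n + 1)) + 1 / (2 * γ) *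
      ((∑ k ∈ Finset.Icc 1 n, (l1Coeff α τ (n + 1 - k - 1) - l1Coeff α τ (n + 1 - k)) *
        gradNormSq (Ψ (n + 1) k)) + l1Coeff α τ n * gradNormSq (Ψ (n + 1) 0)) := by
  rw [modifiedEnergy, if_neg n.succ_ne_zero, Nat.add_sub_cancel]
  ring

lemma energy_step_le (hΩb : Bornology.IsBounded Ω) {bc : BoundaryCondition d}
    {α τ γ ε M S : ℝ} {N : ℕ} (hγ : 0 < γ) (hM : 1 ≤ M) (hS : (3 * M ^ 2 - 1) / 2 ≤ S)
    {u : ℕ → H1Function Ω} (hu : IsL1ImexSolution bc α τ γ ε M S N u)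
    {Ψ : ℕ → ℕ → H1Function Ω}
    (hΨ : ∀ n k, k < n → n ≤ N →
      IsPoissonSolution bc (Ψ n k) (fun x => (u n).toFun x - (u k).toFun x))
    {n : ℕ} (hn : n + 1 ≤ N) {D : ℕ → MeasureTheory.Lp (Space d) 2
      (MeasureTheory.volume.restrict Ω)}
    (hD : ∀ k, k ≤ n → D k = (Ψ (n + 1) k).der) (hD0 : D (n + 1) = 0) :
    energy ε M (u (n + 1)) + 1 / (2 * γ) * (2 * ∑ k ∈ Finset.Icc 1 (n + 1),
      l1Coeff α τ (n + 1 - k) * inner ℝ (D (k - 1) - D k) (D n)) ≤ energy ε M (u n) := by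
  obtain ⟨w, hw, h1, h2⟩ := hu.step (n + 1) (by omega) hn
  have hp := hΨ (n + 1) n (by omega) hn
  have hE := energy_sub_le hΩb hM hS (hu.boundary (n + 1) hn) (hu.boundary n (by omega)) h2
  have hdual : ∀ k, k ≤ n + 1 → inner ℝ (D k) (Ψ (n + 1) n).der =
      inner ℝ ((u (n + 1)).val - (u k).val) (Ψ (n + 1) n).val := by
    intro k hk
    rcases Nat.lt_or_ge k (n + 1) with h | h
    · rw [hD k (by omega), (hΨ (n + 1) k h hn).inner_der hp.1]
    · rw [le_antisymm hk h, hD0, sub_self, inner_zero_left, inner_zero_left]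
  have hsum : ∑ k ∈ Finset.Icc 1 (n + 1),
      l1Coeff α τ (n + 1 - k) * inner ℝ (D (k - 1) - D k) (D n) =
      -(γ * inner ℝ w.der (Ψ (n + 1) n).der) := by
    rw [← integral_inner_grad, ← h1 _ hp.1, integral_l1Deriv_mul]
    refine Finset.sum_congr rfl fun k hk => ?_
    rw [Finset.mem_Icc] at hk
    rw [hD n le_rfl, inner_sub_left, hdual k hk.2, hdual (k - 1) (by omega), ← inner_sub_left,
      sub_sub_sub_cancel_left]
  -- The Poisson problem tested with `w` turns `⟨w, uⁿ⁺¹ - uⁿ⟩` into `⟨∇w, ∇Ψ⟩`.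
  rw [real_inner_comm, ← hp.inner_der hw, real_inner_comm] at hE
  rw [hsum]
  field_simp
  linarith

end

end TFCH

theorem mainTheorem8 {d : ℕ} (Ω : Set (TFCH.Space d)) (hΩ : IsOpen Ω)
    (hΩb : Bornology.IsBounded Ω)
    (bc : TFCH.BoundaryCondition d) (hbc : bc.Admissible Ω)
    (α T γ ε M S : ℝ) (N : ℕ)
    (hα0 : 0 < α) (hα1 : α < 1) (hT : 0 < T) (hγ : 0 < γ) (hε : 0 < ε) (hM : 1 ≤ M)
    (hS : (3 * M ^ 2 - 1) / 2 ≤ S)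
    (u : ℕ → TFCH.H1Function Ω)
    (hu : TFCH.IsL1ImexSolution bc α (T / N) γ ε M S N u)
    (Ψ : ℕ → ℕ → TFCH.H1Function Ω)
    (hΨ : ∀ n k, k < n → n ≤ N →
      TFCH.IsPoissonSolution bc (Ψ n k) (fun x => (u n).toFun x - (u k).toFun x)) :
    ∀ n, 1 ≤ n → n ≤ N →
      TFCH.modifiedEnergy α (T / N) γ ε M u Ψ n ≤
        TFCH.modifiedEnergy α (T / N) γ ε M u Ψ (n - 1) := by
  intro n hn1 hnN
  have hτ : 0 < T / N := div_pos hT (by exact_mod_cast (by omega : 0 < N))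
  obtain ⟨j, rfl⟩ := Nat.exists_eq_add_of_le' hn1
  -- `Ψ (j + 1) (j + 1)` is unconstrained; zero is the gradient matching the datum `uⁿ - uⁿ = 0`.
  let D := fun k => if k ≤ j then (Ψ (j + 1) k).der else 0
  have hD : ∀ k, k ≤ j → D k = (Ψ (j + 1) k).der := fun k hk => if_pos hk
  have hD0 : D (j + 1) = 0 := if_neg (by omega)
  have hstep := TFCH.energy_step_le hΩb hγ hM hS hu hΨ hnN hD hD0
  have hγ' : 0 ≤ 1 / (2 * γ) := by positivity
  have hnorm : ∀ k, k ≤ j → TFCH.gradNormSq (Ψ (j + 1) k) = ‖D k‖ ^ 2 := fun k hk => by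
    rw [hD k hk, TFCH.gradNormSq_eq]
  rw [Nat.add_sub_cancel, TFCH.modifiedEnergy_succ, hnorm 0 j.zero_le]
  -- The first step is separate because the energy at level `0` carries no history.
  cases j with
  | zero =>
    have h := mul_le_mul_of_nonneg_left (TFCH.history_le_zero (TFCH.l1Coeff α (T / N))
      (TFCH.l1Coeff_nonneg hα1 hτ 0) D hD0) hγ'
    rw [TFCH.modifiedEnergy_zero]
    rw [Finset.Icc_eq_empty (by norm_num), Finset.sum_empty, zero_add]
    simp only [zero_add] at hstep ⊢
    linarith
  | succ m =>
    have h := mul_le_mul_of_nonneg_left (TFCH.history_le_succ (TFCH.l1Coeff α (T / N))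
      (TFCH.l1Coeff_nonneg hα1 hτ) (TFCH.l1Coeff_succ_le hα0 hα1 hτ)
      (TFCH.l1Coeff_convex hα0 hα1 hτ) D m hD0) hγ'
    have hdiff : ∀ k, k ≤ m →
        TFCH.gradNormSq (Ψ (m + 1) k) = ‖D k - D (m + 1)‖ ^ 2 := fun k hk => by
      rw [TFCH.gradNormSq_eq, hD k (by omega), hD (m + 1) le_rfl]
      exact (TFCH.norm_der_eq_of_isPoissonSolution hΩb (hΨ _ k (by omega) hnN)
        (hΨ _ (m + 1) (by omega) hnN) (hΨ (m + 1) k (by omega) (by omega))).symm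
    rw [TFCH.modifiedEnergy_succ, hdiff 0 m.zero_le,
      Finset.sum_congr rfl fun k hk => by rw [hnorm k (Finset.mem_Icc.1 hk).2],
      Finset.sum_congr (s₁ := Finset.Icc 1 m) rfl fun k hk => by
        rw [hdiff k (Finset.mem_Icc.1 hk).2]]
    rw [mul_add (1 / (2 * γ)) (_ + _) (2 * _)] at h
    linarith
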